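/- Let $\Sigma_n=(K_n,\sigma,\mathbb F_2^m)$ be a multisigned complete graph, that is, $K_n$ is the complete graph on $n$ vertices and $\sigma:E(K_n)\to\mathbb F_2^m$. The multisign $\sigma(C)$ of a circle (simple cycle) $C$ is the sum of the labels of its edges; $e=(0,\dots,0)$ is the identity of $\mathbb F_2^m$; and $\eta(t)$ is the number of triangles of $\Sigma_n$ with multisign $t$. For $x\in\mathbb F_2^m$ let $\Sigma_n^x=(K_n,x+\sigma,\mathbb F_2^m)$ be obtained by adding $x$ to the label of every edge. Triangles $T_1,\dots,T_r$ are almost-disjoint if any two distinct ones share at most one vertex and among any three at least one is disjoint from the other two. To normalize a vertex $v$ means to replace each label $\sigma(uw)$ by $\sigma(uw)+f(u)+f(w)$, where $f(v)=e$ and $f(u)=\sigma(vu)$ for $u\neq v$, so that every edge at $v$ gets the label $e$. A multisigned complete graph with labels in $\mathbb F_2^m$ is called special if neither of the following holds: (a) it contains almost-disjoint triangles $T_1,\dots,T_m$ whose multisigns are linearly independent; (b) for some vertex $v$, after normalizing $v$, there are edges $e_1,\dots,e_m$ not incident to $v$ that all lie on one path and have linearly independent labels, while all other edges not incident to $v$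 have one and the same label. **Lemma.** For every $m$ there is an $N=N(m)$ such that the following holds for all $n\ge N$ and every $\Sigma_n=(K_n,\sigma,\mathbb F_2^m)$. Suppose that $x\in\mathbb F_2^m$, $x\neq e$, satisfies $\eta(x)\ge\eta(t)$ for all $t\in\mathbb F_2^m$, that there exist triangles in $\Sigma_n$ whose multisigns $x_1,\dots,x_m$ are linearly independent, and that at least one triangle of $\Sigma_n$ has multisign $e$. If $\Sigma_n^x$ is not special, then every element of $\mathbb F_2^m$ is the multisign of some Hamiltonian circle of $\Sigma_n$, i.e. $\{\sigma(H): H \text{ a Hamiltonian circle of }\Sigma_n\}=\mathbb F_2^m$. -/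

import Mathlib

namespace Multisigned

/-- The group of multisigns, the vector space of dimension `m` over the field with two elements. -/
abbrev Multisign (m : ℕ) : Type := Fin m → ZMod 2

/-- An edge labelling of the complete graph on `V`. Only the values at pairs of distinct vertices
are ever used. -/
abbrev Labelling (V : Type) (m : ℕ) : Type := Sym2 V → Multisign m

variable {V : Type} [DecidableEq V] {m : ℕ}

/-- The multisign of a set of edges: the sum of their labels. -/
def edgeSum (σ : Labelling V m) (E : Finset (Sym2 V)) : Multisign m := ∑ e ∈ E, σ e

/-- The edges of the complete graph that join two vertices of `T`. If `T` has three vertices,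
these are the three edges of the triangle on `T`. -/
def edgesWithin (T : Finset V) : Finset (Sym2 V) := T.sym2.filter (fun e => ¬ e.IsDiag)

/-- The multisign of the triangle with vertex set `T`. -/
def triangleSign (σ : Labelling V m) (T : Finset V) : Multisign m := edgeSum σ (edgesWithin T)

/-- `eta σ t` is the number of triangles with multisign `t`. -/
def eta [Fintype V] (σ : Labelling V m) (t : Multisign m) : ℕ :=
  ((Finset.univ.powersetCard 3).filter (fun T : Finset V => triangleSign σ T = t)).card

/-- The set of the multisigns of all Hamiltonian circles. -/
def hamiltonianSigns (σ : Labelling V m) : Set (Multisign m) :=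
  {g | ∃ (a : V) (w : (⊤ : SimpleGraph V).Walk a a),
    w.IsHamiltonianCycle ∧ edgeSum σ w.edges.toFinset = g}

/-- Adding the same multisign `x` to the label of every edge. -/
def translate (x : Multisign m) (σ : Labelling V m) : Labelling V m := fun e => x + σ e

/-- Switching by `f`: the label of `uw` becomes `σ(uw) + f(u) + f(w)`. -/
def switch (σ : Labelling V m) (f : V → Multisign m) : Labelling V m :=
  fun e => σ e + Sym2.lift ⟨fun u w => f u + f w, fun u w => add_comm (f u) (f w)⟩ e

/-- Normalization of `v`: the switching at the vertices other than `v` after which every edge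
incident to `v` has label `0`. -/
def normalizeVertex (σ : Labelling V m) (v : V) : Labelling V m :=
  switch σ (fun u => if u = v then 0 else σ s(v, u))

/-- Almost-disjoint triangles: two of them share at most one vertex, and among any three of them
at least one is disjoint from the other two. -/
def AlmostDisjoint {ι : Type} (T : ι → Finset V) : Prop :=
  (∀ i j, i ≠ j → (T i ∩ T j).card ≤ 1) ∧
  ∀ i j k, i ≠ j → i ≠ k → j ≠ k →
    (Disjoint (T i) (T j) ∧ Disjoint (T i) (T k)) ∨
    (Disjoint (T j) (T i) ∧ Disjoint (T j) (T k)) ∨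
    (Disjoint (T k) (T i) ∧ Disjoint (T k) (T j))

/-- There are `m` triangles with linearly independent multisigns. -/
def HasIndependentTriangles (σ : Labelling V m) : Prop :=
  ∃ T : Fin m → Finset V, (∀ i, (T i).card = 3) ∧
    LinearIndependent (ZMod 2) (fun i => triangleSign σ (T i))

/-- There are `m` almost-disjoint triangles with linearly independent multisigns. -/
def HasAlmostDisjointIndependentTriangles (σ : Labelling V m) : Prop :=
  ∃ T : Fin m → Finset V, (∀ i, (T i).card = 3) ∧ AlmostDisjoint T ∧
    LinearIndependent (ZMod 2) (fun i => triangleSign σ (T i))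

/-- After normalization of some vertex `v`, there are `m` edges that avoid `v`, lie on a common
path and have linearly independent labels, while all other edges that avoid `v` have one and the
same label `y`. -/
def IsPathConfiguration (σ : Labelling V m) : Prop :=
  ∃ (v : V) (d : Fin m → Sym2 V) (y : Multisign m),
    (∀ i, v ∉ d i) ∧
    (∃ (a b : V) (p : (⊤ : SimpleGraph V).Walk a b), p.IsPath ∧ ∀ i, d i ∈ p.edges) ∧
    LinearIndependent (ZMod 2) (fun i => normalizeVertex σ v (d i)) ∧
    ∀ e : Sym2 V, ¬ e.IsDiag → v ∉ e → (∀ i, e ≠ d i) → normalizeVertex σ v e = y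

/-- The special cases: no almost-disjoint triangles with `m` linearly independent multisigns
exist, and the labelling is not a path configuration either. -/
def IsSpecial (σ : Labelling V m) : Prop :=
  ¬ HasAlmostDisjointIndependentTriangles σ ∧ ¬ IsPathConfiguration σ

end Multisigned

/-! Adding `x` to every label adds `n • x` to the multisign of every Hamiltonian circle and `x` to
that of every triangle. After this translation zero is the most frequent triangle multisign, so for
large `n` a zero triangle avoids any prescribed small set of vertices (`exists_zero_triangle`).
Failure of being special leaves two cases.

In a path configuration, a zero triangle away from `v` and the `m` edges forces the common label to
be zero. The normalized labelling is then supported on `m` independent edges of a path. A circle can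
follow this path and detour through vertices of zero label around the unwanted edges, so it collects
any subset sum (`hamiltonianFull_of_path`).

With almost-disjoint independent triangles, paths on a fixed vertex set with fixed ends are made to
realise a coset of a growing subspace (`Flexible`). Outside the triangles, a family whose subspace
`W` is maximal absorbs everything: exchanging two inner vertices shows that triangles sharing an
edge agree modulo `W`, and a zero triangle puts them all in `W` (`exists_absorbing_flexible`). Each
given triangle then contributes its multisign modulo `W` by moving one vertex along a path of five
vertices (`exists_triangle_gadget`). Almost-disjointness means that triangles meet at most in pairs,
at one vertex, so their gadgets can be chained (`exists_flexible_of_almostDisjoint`). The subspace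
becomes everything, and the paths close up to Hamiltonian circles. -/

namespace Multisigned

/-! ### Label sums along vertex lists and Hamiltonian circles -/

section

variable {V : Type} {m : ℕ}

/-- The edges joining consecutive vertices of a list. -/
def listEdges : List V → List (Sym2 V)
  | a :: b :: l => s(a, b) :: listEdges (b :: l)
  | _ => []

/-- The sum of the labels of the edges joining consecutive vertices of a list. -/
def pathSum (σ : Labelling V m) (l : List V) : Multisign m := ((listEdges l).map σ).sum

@[simp] lemma pathSum_singleton (σ : Labelling V m) (a : V) : pathSum σ [a] = 0 := rfl

@[simp] lemma pathSum_cons_cons (σ : Labelling V m) (a b : V) (l : List V) :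
    pathSum σ (a :: b :: l) = σ s(a, b) + pathSum σ (b :: l) := by
  simp [pathSum, listEdges]

lemma multisign_add_self (g : Multisign m) : g + g = 0 := by
  ext i
  simpa using CharTwo.add_self_eq_zero (g i)

lemma pathSum_append (σ : Labelling V m) {l : List V} {w : V} (h : l.getLast? = some w)
    (t : List V) : pathSum σ (l ++ t) = pathSum σ l + pathSum σ (w :: t) := by
  induction l with
  | nil => simp at h
  | cons a l ih =>
    cases l with
    | nil => simp at h; simp [h]
    | cons b l =>
      have := ih (by simpa using h)
      simp only [List.cons_append, pathSum_cons_cons] at this ⊢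
      rw [this, add_assoc]

lemma pathSum_reverse (σ : Labelling V m) (l : List V) :
    pathSum σ l.reverse = pathSum σ l := by
  induction l with
  | nil => rfl
  | cons a l ih =>
    cases l with
    | nil => rfl
    | cons b l =>
      rw [List.reverse_cons, pathSum_append σ (w := b) (by simp), ih]
      simp [Sym2.eq_swap, add_comm]

lemma pathSum_translate (x : Multisign m) (σ : Labelling V m) (a : V) (l : List V) :
    pathSum (translate x σ) (a :: l) = l.length • x + pathSum σ (a :: l) := by
  induction l generalizing a with
  | nil => simp
  | cons b l ih =>
    simp only [pathSum_cons_cons, ih, translate, List.length_cons, add_smul, one_smul]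
    abel

lemma pathSum_switch (σ : Labelling V m) (f : V → Multisign m) (a : V) {l : List V} {w : V}
    (h : (a :: l).getLast? = some w) :
    pathSum (switch σ f) (a :: l) = pathSum σ (a :: l) + (f a + f w) := by
  induction l generalizing a with
  | nil => simp at h; simp [h, multisign_add_self]
  | cons b l ih =>
    simp only [pathSum_cons_cons, ih b (by simpa using h), switch, Sym2.lift_mk]
    have := multisign_add_self (f b)
    rw [show σ s(a, b) + (f a + f b) + (pathSum σ (b :: l) + (f b + f w)) =
      σ s(a, b) + pathSum σ (b :: l) + (f a + f w) + (f b + f b) by abel, this, add_zero]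

lemma exists_walk_of_isChain {a : V} {l : List V} (h : (a :: l).IsChain (· ≠ ·)) {b : V}
    (hb : (a :: l).getLast? = some b) :
    ∃ w : (⊤ : SimpleGraph V).Walk a b, w.support = a :: l ∧ w.edges = listEdges (a :: l) := by
  induction l generalizing a with
  | nil =>
    simp at hb
    subst hb
    exact ⟨.nil, rfl, rfl⟩
  | cons c l ih =>
    rw [List.isChain_cons_cons] at h
    obtain ⟨w, hs, he⟩ := ih h.2 (by simpa using hb)
    exact ⟨.cons (by simpa using h.1) w, by simp [hs], by simp [he, listEdges]⟩

lemma edges_eq_listEdges {G : SimpleGraph V} {a b : V} (p : G.Walk a b) :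
    p.edges = listEdges p.support := by
  induction p with
  | nil => rfl
  | cons h p ih =>
    cases p with
    | nil => rfl
    | cons h' p => simpa [listEdges] using ih

/-- The labelling has closed vertex lists through all vertices with every multisign. -/
def HamiltonianFull (σ : Labelling V m) : Prop :=
  ∀ g, ∃ (a : V) (l : List V), (a :: l).Nodup ∧ (∀ x, x ∈ a :: l) ∧
    pathSum σ (a :: l ++ [a]) = g

lemma HamiltonianFull.of_translate {n : ℕ} {σ : Labelling (Fin n) m} {x : Multisign m}
    (h : HamiltonianFull (translate x σ)) : HamiltonianFull σ := by
  intro g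
  obtain ⟨a, l, hn, hc, hg⟩ := h (n • x + g)
  refine ⟨a, l, hn, hc, ?_⟩
  have hlen : (l ++ [a]).length = n := by
    have h1 : (a :: l).toFinset = Finset.univ := by
      ext y; simpa using hc y
    have h2 := List.toFinset_card_of_nodup hn
    rw [h1] at h2
    simpa using h2.symm
  rw [List.cons_append, pathSum_translate, hlen] at hg
  exact add_left_cancel hg

/-- Along a path the switching terms telescope to the two ends, which coincide on a closed list and
cancel in characteristic two. -/
lemma HamiltonianFull.of_switch {σ : Labelling V m} {f : V → Multisign m}
    (h : HamiltonianFull (switch σ f)) : HamiltonianFull σ := by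
  intro g
  obtain ⟨a, l, hn, hc, hg⟩ := h g
  refine ⟨a, l, hn, hc, ?_⟩
  rw [List.cons_append, pathSum_switch σ f a (w := a) (by simp [List.getLast?_cons]),
    multisign_add_self, add_zero] at hg
  exact hg

lemma HamiltonianFull.hamiltonianSigns_eq {n : ℕ} (hn3 : 3 ≤ n) {σ : Labelling (Fin n) m}
    (h : HamiltonianFull σ) : hamiltonianSigns σ = Set.univ := by
  refine Set.eq_univ_of_forall fun g => ?_
  obtain ⟨a, l, hn, hc, hg⟩ := h g
  have hlen : l.length + 1 = n := by
    have h1 : (a :: l).toFinset = Finset.univ := by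
      ext y; simpa using hc y
    have h2 := List.toFinset_card_of_nodup hn
    rw [h1] at h2
    simpa using h2.symm
  cases l with
  | nil => simp at hlen; omega
  | cons b l =>
    have hn' : (b :: l ++ [a]).Nodup := by
      have : (b :: l ++ [a]).Perm (a :: b :: l) := List.perm_append_singleton _ _
      exact this.nodup_iff.mpr hn
    have hab : a ≠ b := by
      rintro rfl; simp at hn
    obtain ⟨w, hs, he⟩ := exists_walk_of_isChain (a := b) (l := l ++ [a]) (b := a)
      (List.Pairwise.isChain hn') (by simp [List.getLast?_cons])
    have hw : w.IsPath := by
      rw [SimpleGraph.Walk.isPath_def, hs]; exact hn'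
    have hl : w.length = l.length + 1 := by
      have := w.length_support
      rw [hs] at this
      simpa using this.symm
    simp only [List.length_cons] at hlen
    have hadj : (⊤ : SimpleGraph (Fin n)).Adj a b := by simpa using hab
    have hcyc : (SimpleGraph.Walk.cons hadj w).IsCycle := by
      rw [SimpleGraph.Walk.isCycle_iff_isPath_tail_and_le_length]
      refine ⟨by simpa using hw, ?_⟩
      rw [SimpleGraph.Walk.length_cons]
      omega
    refine ⟨a, .cons hadj w, ?_, ?_⟩
    · rw [SimpleGraph.Walk.isHamiltonianCycle_iff_isCycle_and_length_eq]
      refine ⟨hcyc, ?_⟩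
      rw [SimpleGraph.Walk.length_cons, Fintype.card_fin]
      omega
    · rw [edgeSum, List.sum_toFinset _ hcyc.edges_nodup, SimpleGraph.Walk.edges_cons, he, ← hg]
      rfl

/-! ### Triangle multisigns and the abundance of zero triangles -/

/-- The sum of the labels of the edges of the triangle `abc`. -/
def triSum (σ : Labelling V m) (a b c : V) : Multisign m := σ s(a, b) + σ s(b, c) + σ s(a, c)

lemma triSum_switch (σ : Labelling V m) (f : V → Multisign m) (a b c : V) :
    triSum (switch σ f) a b c = triSum σ a b c := by
  simp only [triSum, switch, Sym2.lift_mk]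
  rw [show σ s(a, b) + (f a + f b) + (σ s(b, c) + (f b + f c)) + (σ s(a, c) + (f a + f c)) =
    σ s(a, b) + σ s(b, c) + σ s(a, c) + ((f a + f a) + (f b + f b) + (f c + f c)) by abel]
  simp only [multisign_add_self, add_zero]

lemma triSum_rotate (τ : Labelling V m) (a b c : V) : triSum τ a b c = triSum τ b c a := by
  simp only [triSum]
  rw [Sym2.eq_swap (a := c) (b := a), Sym2.eq_swap (a := b) (b := a)]
  abel

/-- Each edge of a tetrahedron lies on two of its four faces, so the face sums add up to zero. -/
lemma triSum_tetrahedron (τ : Labelling V m) (c p q y : V) :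
    triSum τ c p q = triSum τ p q y + (triSum τ c p y + triSum τ c q y) := by
  simp only [triSum]
  have h1 := multisign_add_self (τ s(p, y))
  have h2 := multisign_add_self (τ s(q, y))
  have h3 := multisign_add_self (τ s(c, y))
  rw [show τ s(p, q) + τ s(q, y) + τ s(p, y) + (τ s(c, p) + τ s(p, y) + τ s(c, y) +
    (τ s(c, q) + τ s(q, y) + τ s(c, y))) = τ s(c, p) + τ s(p, q) + τ s(c, q) +
    ((τ s(p, y) + τ s(p, y)) + (τ s(q, y) + τ s(q, y)) + (τ s(c, y) + τ s(c, y))) by abel,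
    h1, h2, h3]
  simp

variable [DecidableEq V]

lemma triangleSign_eq_triSum (σ : Labelling V m) {a b c : V} (hab : a ≠ b) (hac : a ≠ c)
    (hbc : b ≠ c) : triangleSign σ {a, b, c} = triSum σ a b c := by
  have : edgesWithin ({a, b, c} : Finset V) = {s(a, b), s(b, c), s(a, c)} := by
    ext e
    induction e with
    | _ u v =>
      simp only [edgesWithin, Finset.mem_filter, Finset.mk_mem_sym2_iff, Finset.mem_insert,
        Finset.mem_singleton, Sym2.mk_isDiag_iff, Sym2.eq_iff]
      constructor
      · rintro ⟨⟨rfl | rfl | rfl, rfl | rfl | rfl⟩, h⟩ <;> simp_all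
      · rintro ((⟨rfl, rfl⟩ | ⟨rfl, rfl⟩) | (⟨rfl, rfl⟩ | ⟨rfl, rfl⟩) | (⟨rfl, rfl⟩ | ⟨rfl, rfl⟩)) <;>
          simp_all [eq_comm]
  rw [triangleSign, edgeSum, this, Finset.sum_insert, Finset.sum_insert, Finset.sum_singleton,
    triSum, add_assoc]
  · simp [hab.symm, hbc]
  · simp [hab, hac, hbc, hab.symm]

lemma triangleSign_translate (x : Multisign m) (σ : Labelling V m) {T : Finset V}
    (hT : T.card = 3) : triangleSign (translate x σ) T = x + triangleSign σ T := by
  obtain ⟨a, b, c, hab, hac, hbc, rfl⟩ := Finset.card_eq_three.mp hT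
  rw [triangleSign_eq_triSum _ hab hac hbc, triangleSign_eq_triSum _ hab hac hbc]
  simp only [triSum, translate]
  rw [show x + σ s(a, b) + (x + σ s(b, c)) + (x + σ s(a, c)) =
    x + (σ s(a, b) + σ s(b, c) + σ s(a, c)) + (x + x) by abel, multisign_add_self, add_zero]

lemma eta_translate [Fintype V] (x t : Multisign m) (σ : Labelling V m) :
    eta (translate x σ) t = eta σ (x + t) := by
  refine congrArg Finset.card (Finset.filter_congr fun T hT => ?_)
  rw [triangleSign_translate x σ (Finset.mem_powersetCard.mp hT).2]
  constructor
  · rintro rfl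
    rw [← add_assoc, multisign_add_self, zero_add]
  · intro h
    rw [h, ← add_assoc, multisign_add_self, zero_add]

/-- If zero is the most frequent multisign of triangles, then a zero triangle avoids any given
small set of vertices. -/
lemma exists_zero_triangle {n : ℕ} {τ : Labelling (Fin n) m}
    (hη : ∀ t, eta τ t ≤ eta τ 0) (B : Finset (Fin n)) (hB : 48 * 2 ^ m * (B.card + 1) ≤ n) :
    ∃ a b c, a ≠ b ∧ a ≠ c ∧ b ≠ c ∧ a ∉ B ∧ b ∉ B ∧ c ∉ B ∧ triSum τ a b c = 0 := by
  by_contra hcon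
  have hpos : 1 ≤ 2 ^ m := Nat.one_le_two_pow
  have h48 : 48 ≤ n := by nlinarith
  -- Under the contrary assumption every zero triangle has a vertex in `B`, which leaves at most `n
  -- ^ 2` choices for the other two.
  have h1 : eta τ 0 ≤ B.card * n ^ 2 := by
    have hsub : (Finset.univ.powersetCard 3).filter
        (fun T : Finset (Fin n) => triangleSign τ T = 0) ⊆
        (B ×ˢ (Finset.univ : Finset (Fin n × Fin n))).image
          (fun q => {q.1, q.2.1, q.2.2}) := by
      intro T hT
      rw [Finset.mem_filter, Finset.mem_powersetCard] at hT
      obtain ⟨a, b, c, hab, hac, hbc, rfl⟩ := Finset.card_eq_three.mp hT.1.2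
      rw [triangleSign_eq_triSum _ hab hac hbc] at hT
      simp only [Finset.mem_image, Finset.mem_product, Finset.mem_univ, and_true, Prod.exists]
      by_cases ha : a ∈ B
      · exact ⟨a, b, c, ha, rfl⟩
      by_cases hb : b ∈ B
      · exact ⟨b, a, c, hb, by ext; simp; tauto⟩
      by_cases hc : c ∈ B
      · exact ⟨c, a, b, hc, by ext; simp; tauto⟩
      exact absurd ⟨a, b, c, hab, hac, hbc, ha, hb, hc, hT.2⟩ hcon
    calc eta τ 0 ≤ _ := Finset.card_le_card hsub
      _ ≤ _ := Finset.card_image_le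
      _ = B.card * n ^ 2 := by
        rw [Finset.card_product, Finset.card_univ, Fintype.card_prod, Fintype.card_fin, sq]
  -- All triangles are distributed over `2 ^ m` multisigns, of which zero is the most frequent.
  have h2 : n.choose 3 ≤ 2 ^ m * eta τ 0 := by
    have : ((Finset.univ : Finset (Fin n)).powersetCard 3).card =
        ∑ t : Multisign m, eta τ t :=
      Finset.card_eq_sum_card_fiberwise (fun _ _ => Finset.mem_coe.mpr (Finset.mem_univ _))
    rw [Finset.card_powersetCard, Finset.card_univ, Fintype.card_fin] at this
    rw [this]
    refine (Finset.sum_le_card_nsmul _ _ _ fun t _ => hη t).trans ?_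
    simp [ZMod.card]
  have h3 : n ^ 3 ≤ 48 * n.choose 3 := by
    have h6 : 6 * n.choose 3 = n * (n - 1) * (n - 2) := by
      have := Nat.descFactorial_eq_factorial_mul_choose n 3
      simpa [Nat.descFactorial, Nat.factorial, mul_comm, mul_left_comm, mul_assoc] using this.symm
    have e1 : n ≤ 2 * (n - 1) := by omega
    have e2 : n ≤ 2 * (n - 2) := by omega
    calc n ^ 3 = n * n * n := by ring
      _ ≤ n * (2 * (n - 1)) * (2 * (n - 2)) := by gcongr
      _ = 4 * (6 * n.choose 3) := by rw [h6]; ring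
      _ ≤ 48 * n.choose 3 := by omega
  have h4 : n ^ 3 ≤ 48 * 2 ^ m * B.card * n ^ 2 := by
    calc n ^ 3 ≤ 48 * n.choose 3 := h3
      _ ≤ 48 * (2 ^ m * (B.card * n ^ 2)) := by gcongr; exact h2.trans (by gcongr)
      _ = _ := by ring
  have h5 : n ≤ 48 * 2 ^ m * B.card := by
    have : 0 < n ^ 2 := by positivity
    refine Nat.le_of_mul_le_mul_right ?_ this
    calc n * n ^ 2 = n ^ 3 := by ring
      _ ≤ _ := h4
  nlinarith

end

/-! ### Path configurations -/

section

variable {V : Type} {m : ℕ}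

/-- Deleting other entries cannot separate two neighbours that are both kept. -/
lemma mem_listEdges_filter (P : V → Prop) [DecidablePred P] {a b : V} (ha : P a) (hb : P b)
    {l : List V} (h : s(a, b) ∈ listEdges l) : s(a, b) ∈ listEdges (l.filter P) := by
  induction l with
  | nil => simp [listEdges] at h
  | cons c l ih =>
    cases l with
    | nil => simp [listEdges] at h
    | cons d l =>
      simp only [listEdges, List.mem_cons] at h
      rcases h with h | h
      · have hc : P c ∧ P d := by
          rcases Sym2.eq_iff.mp h with ⟨rfl, rfl⟩ | ⟨rfl, rfl⟩
          · exact ⟨ha, hb⟩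
          · exact ⟨hb, ha⟩
        simp [hc.1, hc.2, listEdges, h]
      · have := ih h
        by_cases hc : P c
        · rw [List.filter_cons_of_pos (by simpa using hc)]
          generalize List.filter P (d :: l) = t at this ⊢
          cases t with
          | nil => simp [listEdges] at this
          | cons e t => exact List.mem_cons_of_mem _ this
        · rwa [List.filter_cons_of_neg (by simpa using hc)]

lemma mem_of_mem_listEdges {e : Sym2 V} {x : V} {l : List V} (he : e ∈ listEdges l)
    (hx : x ∈ e) : x ∈ l := by
  induction l with
  | nil => simp [listEdges] at he
  | cons c l ih =>
    cases l with
    | nil => simp [listEdges] at he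
    | cons d l =>
      simp only [listEdges, List.mem_cons] at he
      rcases he with rfl | he
      · rcases Sym2.mem_iff.mp hx with rfl | rfl <;> simp
      · exact List.mem_cons_of_mem _ (ih he)

lemma nodup_listEdges {l : List V} (h : l.Nodup) : (listEdges l).Nodup := by
  induction l with
  | nil => simp [listEdges]
  | cons c l ih =>
    cases l with
    | nil => simp [listEdges]
    | cons d l =>
      rw [List.nodup_cons] at h
      exact List.nodup_cons.mpr
        ⟨fun hm => h.1 (mem_of_mem_listEdges hm (Sym2.mem_mk_left c d)), ih h.2⟩

/-- Every edge starts at a vertex outside `R`; only the final vertex `a` may lie in `R`. This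
disposes of the unused vertices when a circle is closed. -/
lemma pathSum_eq_zero_of_negligible {ν : Labelling V m} {R : V → Prop}
    (hz : ∀ z y, ¬ R z → z ≠ y → ν s(z, y) = 0) {a z : V} {l : List V}
    (hn : (z :: l ++ [a]).Nodup) (hR : ∀ y ∈ z :: l, ¬ R y) : pathSum ν (z :: l ++ [a]) = 0 := by
  induction l generalizing z with
  | nil =>
    have : z ≠ a := by simpa using hn
    simpa using hz z a (hR z (by simp)) this
  | cons b l ih =>
    rw [List.cons_append, List.nodup_cons] at hn
    have hzb : z ≠ b := fun h => hn.1 (by simp [h])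
    have := ih hn.2 fun y hy => hR y (List.mem_cons_of_mem _ hy)
    simp only [List.cons_append, pathSum_cons_cons] at this ⊢
    rw [this, hz z b (hR z (by simp)) hzb, add_zero]

/-- Vertices all of whose edges have label zero can be inserted into a path in order to suppress
all edges outside a set `K`. -/
lemma exists_suppression {n : ℕ} {ν : Labelling (Fin n) m} {R : Fin n → Prop} [DecidablePred R]
    (hz : ∀ z y, ¬ R z → z ≠ y → ν s(z, y) = 0) (K : Finset (Sym2 (Fin n)))
    (a : Fin n) (t : List (Fin n)) (hn : (a :: t).Nodup) (hR : ∀ y ∈ a :: t, R y)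
    (hcard : (Finset.univ.filter R).card + 2 * (t.length + 1) < n) :
    ∃ l, (a :: l).Nodup ∧ (∀ y ∈ a :: t, y ∈ a :: l) ∧ (∀ y ∈ a :: l, R y → y ∈ a :: t) ∧
      l.length ≤ 2 * t.length ∧
      pathSum ν (a :: l) = (((listEdges (a :: t)).filter (· ∈ K)).map ν).sum := by
  induction t generalizing a with
  | nil => exact ⟨[], by simp, by simp, by simp, by simp, by simp [listEdges]⟩
  | cons b t ih =>
    rw [List.nodup_cons] at hn
    simp only [List.length_cons] at hcard
    obtain ⟨l, h1, h2, h3, h4, h5⟩ := ih b hn.2 (fun y hy => hR y (List.mem_cons_of_mem _ hy))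
      (by omega)
    have hRa : R a := hR a (by simp)
    have ha : a ∉ b :: l := fun h => hn.1 (h3 a h hRa)
    by_cases hK : s(a, b) ∈ K
    · refine ⟨b :: l, List.nodup_cons.mpr ⟨ha, h1⟩, ?_, ?_, by simp only [List.length_cons]; omega,
        ?_⟩
      · intro y hy
        rcases List.mem_cons.mp hy with rfl | hy
        · simp
        · exact List.mem_cons_of_mem _ (h2 y hy)
      · intro y hy hRy
        rcases List.mem_cons.mp hy with rfl | hy
        · simp
        · exact List.mem_cons_of_mem _ (h3 y hy hRy)
      · rw [pathSum_cons_cons, h5, listEdges, List.filter_cons_of_pos (by simpa using hK)]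
        simp
    -- The unwanted edge `ab` is replaced by the detour `azb` through a fresh vertex all of whose
    -- labels vanish.
    · obtain ⟨z, hzmem⟩ : ∃ z, z ∉ Finset.univ.filter R ∪ (b :: l).toFinset := by
        by_contra! hall
        have hu : Finset.univ.filter R ∪ (b :: l).toFinset = Finset.univ :=
          Finset.eq_univ_of_forall hall
        have hle := Finset.card_union_le (Finset.univ.filter R) (b :: l).toFinset
        rw [hu, Finset.card_univ, Fintype.card_fin] at hle
        have := List.toFinset_card_le (b :: l)
        simp only [List.length_cons] at this
        omega
      rw [Finset.mem_union, not_or, Finset.mem_filter, List.mem_toFinset] at hzmem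
      have hRz : ¬ R z := fun h => hzmem.1 ⟨Finset.mem_univ _, h⟩
      have hza : z ≠ a := fun h => hRz (h ▸ hRa)
      have hzb : z ≠ b := fun h => hzmem.2 (by simp [h])
      refine ⟨z :: b :: l, ?_, ?_, ?_, by simp only [List.length_cons]; omega, ?_⟩
      · refine List.nodup_cons.mpr ⟨?_, List.nodup_cons.mpr ⟨hzmem.2, h1⟩⟩
        rw [List.mem_cons, not_or]
        exact ⟨hza.symm, ha⟩
      · intro y hy
        rcases List.mem_cons.mp hy with rfl | hy
        · simp
        · exact List.mem_cons_of_mem _ (List.mem_cons_of_mem _ (h2 y hy))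
      · intro y hy hRy
        rcases List.mem_cons.mp hy with rfl | hy
        · simp
        rcases List.mem_cons.mp hy with rfl | hy
        · exact absurd hRy hRz
        · exact List.mem_cons_of_mem _ (h3 y hy hRy)
      · rw [pathSum_cons_cons, pathSum_cons_cons, h5, listEdges,
          List.filter_cons_of_neg (by simpa using hK), Sym2.eq_swap, hz z a hRz hza,
          hz z b hRz hzb, zero_add, zero_add]

/-- The vectors form a basis, and coefficients in `ZMod 2` amount to the choice of a subset. -/
lemma exists_sum_eq_of_linearIndependent {w : Fin m → Multisign m}
    (hw : LinearIndependent (ZMod 2) w) (g : Multisign m) :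
    ∃ J : Finset (Fin m), ∑ i ∈ J, w i = g := by
  have hs := hw.span_eq_top_of_card_eq_finrank' (by simp)
  obtain ⟨c, hc⟩ := (Submodule.mem_span_range_iff_exists_fun (ZMod 2)).mp
    (hs ▸ Submodule.mem_top : g ∈ Submodule.span (ZMod 2) (Set.range w))
  refine ⟨Finset.univ.filter fun i => c i = 1, ?_⟩
  rw [Finset.sum_filter, ← hc]
  refine Finset.sum_congr rfl fun i _ => ?_
  have h01 : ∀ u : ZMod 2, u = 0 ∨ u = 1 := by decide
  rcases h01 (c i) with h | h <;> simp [h]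

lemma card_vertices_le {n : ℕ} (d : Fin m → Sym2 (Fin n)) :
    (Finset.univ.filter fun y => ∃ i, y ∈ d i).card ≤ 2 * m := by
  have : (Finset.univ.filter fun y => ∃ i, y ∈ d i) ⊆
      Finset.univ.biUnion fun i => (d i).toFinset := by
    intro y
    simp
  refine (Finset.card_le_card this).trans (Finset.card_biUnion_le.trans ?_)
  refine (Finset.sum_le_card_nsmul _ _ 2 fun i _ => ?_).trans (by simp [mul_comm])
  rw [Sym2.card_toFinset]
  split_ifs <;> omega

/-- A labelling that vanishes except on `m` edges with independent labels on a path. -/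
lemma hamiltonianFull_of_path {n : ℕ} (hm : 0 < m) (hn : 6 * m < n) {ν : Labelling (Fin n) m}
    (d : Fin m → Sym2 (Fin n)) {a b : Fin n} (p : (⊤ : SimpleGraph (Fin n)).Walk a b)
    (hp : p.IsPath) (hd : ∀ i, d i ∈ p.edges)
    (hind : LinearIndependent (ZMod 2) fun i => ν (d i))
    (hz : ∀ e : Sym2 (Fin n), ¬ e.IsDiag → (∀ i, e ≠ d i) → ν e = 0) :
    HamiltonianFull ν := by
  intro g
  obtain ⟨J, hJ⟩ := exists_sum_eq_of_linearIndependent hind g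
  set R : Fin n → Prop := fun y => ∃ i, y ∈ d i with hRdef
  have hz' : ∀ z y, ¬ R z → z ≠ y → ν s(z, y) = 0 := fun z y hRz hzy =>
    hz _ (by simpa using hzy) fun i hi => hRz ⟨i, hi ▸ Sym2.mem_mk_left z y⟩
  set l₁ := p.support.filter R with hl₁
  have hmem : ∀ y, y ∈ l₁ ↔ R y := by
    intro y
    simp only [hl₁, List.mem_filter, decide_eq_true_eq, and_iff_right_iff_imp]
    rintro ⟨i, hi⟩
    have := hd i
    rw [edges_eq_listEdges] at this
    exact mem_of_mem_listEdges this hi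
  have hl₁n : l₁.Nodup := hp.support_nodup.filter _
  have hl₁d : ∀ i, d i ∈ listEdges l₁ := by
    intro i
    have h1 := hd i
    rw [edges_eq_listEdges] at h1
    have h2 : ∀ y ∈ d i, R y := fun y hy => ⟨i, hy⟩
    generalize d i = e at h1 h2
    induction e with
    | _ u w => exact mem_listEdges_filter R (h2 u (by simp)) (h2 w (by simp)) h1
  have hcard : (Finset.univ.filter R).card ≤ 2 * m := card_vertices_le d
  have hlen : l₁.length ≤ 2 * m := by
    rw [← List.toFinset_card_of_nodup hl₁n]
    refine le_trans (Finset.card_le_card fun y hy => ?_) hcard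
    simpa using (hmem y).mp (List.mem_toFinset.mp hy)
  clear_value l₁
  cases l₁ with
  | nil => exact absurd (hl₁d ⟨0, hm⟩) (by simp [listEdges])
  | cons a t =>
    simp only [List.length_cons] at hlen
    obtain ⟨l, h1, h2, h3, h4, h5⟩ := exists_suppression hz' (J.image d) a t hl₁n
      (fun y hy => (hmem y).mp hy) (by omega)
    have hsum : pathSum ν (a :: l) = g := by
      rw [h5, ← List.sum_toFinset _ ((nodup_listEdges hl₁n).filter _), ← hJ,
        ← Finset.sum_image (f := ν) (g := d) fun i _ j _ hij => hind.injective (by simp [hij])]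
      congr 1
      ext e
      simp only [List.mem_toFinset, List.mem_filter, decide_eq_true_eq, Finset.mem_image,
        and_iff_right_iff_imp]
      rintro ⟨i, -, rfl⟩
      exact hl₁d i
    -- All vertices of `R` are already visited, so the rest, in any order, returns to `a` without
    -- adding any label.
    set r := (Finset.univ \ (a :: l).toFinset).toList with hr
    have hrmem : ∀ y, y ∈ r ↔ y ∉ a :: l := by
      intro y; simp [hr]
    have hrn : r.Nodup := Finset.nodup_toList _
    clear_value r
    cases r with
    | nil =>
      exfalso
      have hu : (a :: l).toFinset = Finset.univ := by
        ext y
        have := hrmem y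
        simpa [or_iff_not_imp_left] using this
      have h6 := List.toFinset_card_of_nodup h1
      rw [hu, Finset.card_univ, Fintype.card_fin, List.length_cons] at h6
      omega
    | cons z r =>
      obtain ⟨w, hw⟩ : ∃ w, (a :: l).getLast? = some w := by
        simp [List.getLast?_cons]
      have hwl : w ∈ a :: l := List.mem_of_getLast? hw
      have hzw : z ≠ w := fun h => (hrmem z).mp (by simp) (h ▸ hwl)
      refine ⟨a, l ++ z :: r, ?_, ?_, ?_⟩
      · rw [← List.cons_append]
        exact h1.append hrn fun y hy hy' => (hrmem y).mp hy' hy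
      · intro y
        rw [← List.cons_append, List.mem_append, hrmem]
        tauto
      · rw [← List.cons_append, List.append_assoc, pathSum_append ν hw, List.cons_append,
          pathSum_cons_cons, ← List.cons_append,
          pathSum_eq_zero_of_negligible (R := R) hz', hsum, Sym2.eq_swap, hz' z w _ hzw,
          add_zero, add_zero]
        · exact fun h => (hrmem z).mp (by simp) (h2 z ((hmem z).mpr h))
        · refine hrn.append (by simp) fun y hy hy' => ?_
          exact (hrmem y).mp hy (by simp at hy'; simp [hy'])
        · exact fun y hy h => (hrmem y).mp hy (h2 y ((hmem y).mpr h))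

lemma IsPathConfiguration.hamiltonianFull {n : ℕ} (hm : 0 < m)
    (hn : 48 * 2 ^ m * (2 * m + 2) ≤ n) {τ : Labelling (Fin n) m}
    (hη : ∀ t, eta τ t ≤ eta τ 0) (h : IsPathConfiguration τ) : HamiltonianFull τ := by
  obtain ⟨v, d, y, hv, ⟨a, b, p, hp, hd⟩, hind, hy⟩ := h
  have hpos : 1 ≤ 2 ^ m := Nat.one_le_two_pow
  have hcard := card_vertices_le d
  obtain ⟨q, r, s, hqr, hqs, hrs, hq, hr, hs, h0⟩ := exists_zero_triangle hη
    (insert v (Finset.univ.filter fun y => ∃ i, y ∈ d i)) (by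
      refine le_trans (Nat.mul_le_mul_left _ ?_) hn
      have := Finset.card_insert_le v (Finset.univ.filter fun y => ∃ i, y ∈ d i)
      omega)
  simp only [Finset.mem_insert, Finset.mem_filter, Finset.mem_univ, true_and, not_or,
    not_exists] at hq hr hs
  -- The zero triangle has three edges of label `y`, and `3y = y` in characteristic two.
  have hy0 : y = 0 := by
    have key : ∀ u w : Fin n, u ≠ w → u ≠ v → w ≠ v → (∀ i, u ∉ d i) →
        normalizeVertex τ v s(u, w) = y := fun u w huw hu hw hui =>
      hy _ (by simpa using huw) (by simp [hu.symm, hw.symm])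
        fun i hi => hui i (hi ▸ Sym2.mem_mk_left u w)
    rw [← triSum_switch τ (fun u => if u = v then 0 else τ s(v, u))] at h0
    change triSum (normalizeVertex τ v) q r s = 0 at h0
    rw [triSum, key q r hqr hq.1 hr.1 hq.2, key r s hrs hr.1 hs.1 hr.2,
      key q s hqs hq.1 hs.1 hq.2, multisign_add_self, zero_add] at h0
    exact h0
  subst hy0
  refine HamiltonianFull.of_switch (f := fun u => if u = v then 0 else τ s(v, u)) ?_
  refine hamiltonianFull_of_path hm (by nlinarith) d p hp hd hind fun e he hne => ?_
  by_cases hve : v ∈ e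
  · obtain ⟨w, rfl⟩ := hve
    have : w ≠ v := fun h => he (by simp [h])
    simp [switch, this, multisign_add_self]
  · exact hy e he hve hne

end

/-! ### Flexible families of paths -/

section

variable {V : Type} [DecidableEq V] {m : ℕ}

/-- The paths from `u` to `v` with vertex set `S` realise a coset of the subspace `G`. -/
def Flexible (τ : Labelling V m) (u v : V) (S : Finset V)
    (G : Submodule (ZMod 2) (Multisign m)) : Prop :=
  ∃ s, ∀ g ∈ G, ∃ l : List V, l.Nodup ∧ l.toFinset = S ∧ l.head? = some u ∧
    l.getLast? = some v ∧ pathSum τ l = s + g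

lemma flexible_singleton (τ : Labelling V m) (u : V) : Flexible τ u u {u} ⊥ := by
  refine ⟨0, fun g hg => ⟨[u], by simp, by simp, rfl, rfl, ?_⟩⟩
  rw [Submodule.mem_bot] at hg
  simp [hg]

lemma Flexible.reverse {τ : Labelling V m} {u v : V} {S : Finset V}
    {G : Submodule (ZMod 2) (Multisign m)} (h : Flexible τ u v S G) : Flexible τ v u S G := by
  obtain ⟨s, hs⟩ := h
  refine ⟨s, fun g hg => ?_⟩
  obtain ⟨l, h1, h2, h3, h4, h5⟩ := hs g hg
  exact ⟨l.reverse, by simpa using h1, by simpa using h2, by simpa using h4, by simpa using h3,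
    by rw [pathSum_reverse, h5]⟩

lemma Flexible.left_mem {τ : Labelling V m} {u v : V} {S : Finset V}
    {G : Submodule (ZMod 2) (Multisign m)} (h : Flexible τ u v S G) : u ∈ S := by
  obtain ⟨s, hs⟩ := h
  obtain ⟨l, -, h2, h3, -⟩ := hs 0 G.zero_mem
  rw [← h2, List.mem_toFinset]
  exact List.mem_of_head? h3

/-- Joining two families of paths by an edge. -/
lemma Flexible.append {τ : Labelling V m} {u v u' v' : V} {S S' : Finset V}
    {G G' : Submodule (ZMod 2) (Multisign m)} (h : Flexible τ u v S G)
    (h' : Flexible τ u' v' S' G') (hd : Disjoint S S') :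
    Flexible τ u v' (S ∪ S') (G ⊔ G') := by
  obtain ⟨s, hs⟩ := h
  obtain ⟨s', hs'⟩ := h'
  refine ⟨s + τ s(v, u') + s', fun g hg => ?_⟩
  obtain ⟨y, hy, z, hz, rfl⟩ := Submodule.mem_sup.mp hg
  obtain ⟨l, h1, h2, h3, h4, h5⟩ := hs y hy
  obtain ⟨l', h1', h2', h3', h4', h5'⟩ := hs' z hz
  refine ⟨l ++ l', ?_, by rw [List.toFinset_append, h2, h2'], by simp [h3], by simp [h4'], ?_⟩
  · refine h1.append h1' fun x hx hx' => ?_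
    exact Finset.disjoint_left.mp hd (h2 ▸ List.mem_toFinset.mpr hx)
      (h2' ▸ List.mem_toFinset.mpr hx')
  · rw [pathSum_append τ h4, h5]
    cases l' with
    | nil => simp at h3'
    | cons c l' =>
      simp only [List.head?_cons, Option.some.injEq] at h3'
      subst h3'
      rw [pathSum_cons_cons, h5']
      abel

/-- Joining two families of paths at a common end vertex. -/
lemma Flexible.glue {τ : Labelling V m} {u w v : V} {S S' : Finset V}
    {G G' : Submodule (ZMod 2) (Multisign m)} (h : Flexible τ u w S G)
    (h' : Flexible τ w v S' G') (hd : ∀ x ∈ S, x ∈ S' → x = w) :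
    Flexible τ u v (S ∪ S') (G ⊔ G') := by
  have hwS := h.reverse.left_mem
  obtain ⟨s, hs⟩ := h
  obtain ⟨s', hs'⟩ := h'
  refine ⟨s + s', fun g hg => ?_⟩
  obtain ⟨y, hy, z, hz, rfl⟩ := Submodule.mem_sup.mp hg
  obtain ⟨l, h1, h2, h3, h4, h5⟩ := hs y hy
  obtain ⟨l', h1', h2', h3', h4', h5'⟩ := hs' z hz
  cases l' with
  | nil => simp at h3'
  | cons c t =>
    simp only [List.head?_cons, Option.some.injEq] at h3'
    subst h3'
    refine ⟨l ++ t, ?_, ?_, by simp [h3], ?_, ?_⟩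
    · rw [List.nodup_cons] at h1'
      refine h1.append h1'.2 fun x hx hx' => h1'.1 ?_
      rw [← hd x (h2 ▸ List.mem_toFinset.mpr hx)
        (h2' ▸ List.mem_toFinset.mpr (List.mem_cons_of_mem _ hx'))]
      exact hx'
    · rw [List.toFinset_append, h2, ← h2', List.toFinset_cons]
      ext x
      simp only [Finset.mem_union, Finset.mem_insert]
      constructor
      · tauto
      · rintro (hx | rfl | hx)
        · exact Or.inl hx
        · exact Or.inl hwS
        · exact Or.inr hx
    · cases t with
      | nil => simpa [h4] using h4'
      | cons e t => simpa [List.getLast?_cons] using h4'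
    · rw [pathSum_append τ h4, h5, h5']
      abel

/-- Over `ZMod 2` a line has only the elements `0` and `g`, so two paths on the same vertices
suffice. -/
lemma flexible_span_of_lists {τ : Labelling V m} {u v : V} {l l' : List V} {g : Multisign m}
    (hn : l.Nodup) (hp : l.Perm l') (hu : l.head? = some u) (hu' : l'.head? = some u)
    (hv : l.getLast? = some v) (hv' : l'.getLast? = some v)
    (hg : pathSum τ l' = pathSum τ l + g) :
    Flexible τ u v l.toFinset (Submodule.span (ZMod 2) {g}) := by
  refine ⟨pathSum τ l, fun y hy => ?_⟩
  obtain ⟨c, rfl⟩ := Submodule.mem_span_singleton.mp hy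
  have h01 : ∀ u : ZMod 2, u = 0 ∨ u = 1 := by decide
  rcases h01 c with rfl | rfl
  · exact ⟨l, hn, rfl, hu, hv, by simp⟩
  · exact ⟨l', hp.nodup_iff.mp hn, (List.toFinset_eq_of_perm _ _ hp).symm, hu', hv', by simp [hg]⟩

/-- The two orders `abcd` and `acbd`. -/
lemma flexible_four (τ : Labelling V m) {a b c d : V} (hn : [a, b, c, d].Nodup) :
    Flexible τ a d {a, b, c, d}
      (Submodule.span (ZMod 2) {triSum τ a b c + triSum τ d b c}) := by
  have := flexible_span_of_lists (τ := τ) (u := a) (v := d) (l := [a, b, c, d])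
    (l' := [a, c, b, d]) (g := triSum τ a b c + triSum τ d b c) hn
    (List.Perm.cons a (List.Perm.swap c b [d])) rfl rfl rfl rfl (by
      simp only [pathSum_cons_cons, pathSum_singleton, triSum, add_zero]
      rw [Sym2.eq_swap (a := c) (b := b), Sym2.eq_swap (a := d) (b := b),
        Sym2.eq_swap (a := d) (b := c)]
      have h1 := multisign_add_self (τ s(a, b))
      have h2 := multisign_add_self (τ s(c, d))
      have h3 := multisign_add_self (τ s(b, c))
      rw [show τ s(a, b) + (τ s(b, c) + τ s(c, d)) + (τ s(a, b) + τ s(b, c) + τ s(a, c) +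
        (τ s(b, d) + τ s(b, c) + τ s(c, d))) = τ s(a, c) + (τ s(b, c) + τ s(b, d)) +
        ((τ s(a, b) + τ s(a, b)) + (τ s(c, d) + τ s(c, d)) + (τ s(b, c) + τ s(b, c))) by abel,
        h1, h2, h3]
      simp)
  simpa using this

/-- The vertex `c` is moved from between `p` and `q` to between `a` and `b`. -/
lemma flexible_five (τ : Labelling V m) {a b c p q : V} (hn : [a, b, p, c, q].Nodup) :
    Flexible τ a q {a, b, p, c, q}
      (Submodule.span (ZMod 2) {triSum τ a b c + triSum τ c p q}) := by
  have := flexible_span_of_lists (τ := τ) (u := a) (v := q) (l := [a, b, p, c, q])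
    (l' := [a, c, b, p, q]) (g := triSum τ a b c + triSum τ c p q) hn
    (List.Perm.cons a (((List.Perm.swap c p [q]).cons b).trans (List.Perm.swap c b [p, q])))
    rfl rfl rfl rfl (by
      simp only [pathSum_cons_cons, pathSum_singleton, triSum, add_zero]
      rw [Sym2.eq_swap (a := c) (b := b), Sym2.eq_swap (a := c) (b := p)]
      have h1 := multisign_add_self (τ s(a, b))
      have h2 := multisign_add_self (τ s(p, c))
      have h3 := multisign_add_self (τ s(c, q))
      rw [show τ s(a, b) + (τ s(b, p) + (τ s(p, c) + τ s(c, q))) + (τ s(a, b) + τ s(b, c) +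
        τ s(a, c) + (τ s(p, c) + τ s(p, q) + τ s(c, q))) = τ s(a, c) + (τ s(b, c) +
        (τ s(b, p) + τ s(p, q))) +
        ((τ s(a, b) + τ s(a, b)) + (τ s(p, c) + τ s(p, c)) + (τ s(c, q) + τ s(c, q))) by abel,
        h1, h2, h3]
      simp)
  simpa using this

/-- Appending a single new vertex changes the coset but not the subspace; only the end of the path
moves. -/
lemma Flexible.exists_superset {τ : Labelling V m} {u v : V} {S : Finset V}
    {G : Submodule (ZMod 2) (Multisign m)} (h : Flexible τ u v S G) (A : Finset V) :
    ∃ v', Flexible τ u v' (S ∪ A) G := by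
  induction A using Finset.induction_on with
  | empty => exact ⟨v, by simpa using h⟩
  | insert x A _ ih =>
    obtain ⟨v', hv'⟩ := ih
    by_cases hx : x ∈ S ∪ A
    · exact ⟨v', by rwa [Finset.union_insert, Finset.insert_eq_of_mem hx]⟩
    · have := hv'.append (flexible_singleton τ x) (by simpa using hx)
      refine ⟨x, ?_⟩
      rwa [sup_bot_eq, Finset.union_comm _ {x}, ← Finset.insert_eq, ← Finset.union_insert] at this

lemma Flexible.hamiltonianFull {n : ℕ} {τ : Labelling (Fin n) m} {u v : Fin n}
    {S : Finset (Fin n)} (h : Flexible τ u v S ⊤) : HamiltonianFull τ := by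
  obtain ⟨v, s, hs⟩ := h.exists_superset Finset.univ
  intro g
  -- The two extra terms cancel the offset `s` of the coset and the label of the closing edge.
  obtain ⟨l, h1, h2, h3, h4, h5⟩ := hs (s + τ s(v, u) + g) Submodule.mem_top
  cases l with
  | nil => simp at h3
  | cons a t =>
    simp only [List.head?_cons, Option.some.injEq] at h3
    subst h3
    refine ⟨a, t, h1, fun x => ?_, ?_⟩
    · rw [← List.mem_toFinset, h2]
      simp
    · rw [pathSum_append τ h4, h5, pathSum_cons_cons, pathSum_singleton, add_zero,
        show s + (s + τ s(v, a) + g) + τ s(v, a) = (s + s) + (τ s(v, a) + τ s(v, a)) + g by abel,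
        multisign_add_self, multisign_add_self, zero_add, zero_add]

end

/-! ### Absorption of triangles -/

section

variable {m n : ℕ}

lemma exists_three_notMem (A : Finset (Fin n)) (hA : A.card + 3 ≤ n) :
    ∃ a b c, a ∉ A ∧ b ∉ A ∧ c ∉ A ∧ a ≠ b ∧ a ≠ c ∧ b ≠ c := by
  have hc : 3 ≤ Aᶜ.card := by
    rw [Finset.card_compl, Fintype.card_fin]
    omega
  obtain ⟨T, hT, h3⟩ := Finset.exists_subset_card_eq hc
  obtain ⟨a, b, c, hab, hac, hbc, rfl⟩ := Finset.card_eq_three.mp h3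
  simp only [Finset.insert_subset_iff, Finset.singleton_subset_iff, Finset.mem_compl] at hT
  exact ⟨a, b, c, hT.1, hT.2.1, hT.2.2, hab, hac, hbc⟩

/-- A flexible family of paths that absorbs all triangles outside a bounded set. -/
lemma exists_absorbing_flexible {τ : Labelling (Fin n) m} (hη : ∀ t, eta τ t ≤ eta τ 0)
    (U : Finset (Fin n)) (hn : 48 * 2 ^ m * (U.card + 4 * m + 8) ≤ n) :
    ∃ u v S W, Flexible τ u v S W ∧ Disjoint S U ∧ S.card ≤ 4 * m + 1 ∧
      ∀ p q r, p ∉ U ∪ S → q ∉ U ∪ S → r ∉ U ∪ S → p ≠ q → p ≠ r → q ≠ r →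
        triSum τ p q r ∈ W := by
  have hpos : 1 ≤ 2 ^ m := Nat.one_le_two_pow
  have hn' : U.card + 4 * m + 8 ≤ n := by nlinarith
  -- Each new dimension may cost four vertices, so a maximal member still uses at most `4 * m + 1`
  -- vertices.
  set 𝒲 : Set (Submodule (ZMod 2) (Multisign m)) := {W | ∃ u v S, Flexible τ u v S W ∧
    Disjoint S U ∧ S.card ≤ 4 * Module.finrank (ZMod 2) W + 1} with h𝒲
  have hne : 𝒲.Nonempty := by
    obtain ⟨a, -, -, ha, -⟩ := exists_three_notMem U (by omega)
    exact ⟨⊥, a, a, {a}, flexible_singleton τ a, by simpa using ha, by simp⟩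
  obtain ⟨W, ⟨u, v, S, hflex, hdisj, hcard⟩, hmax⟩ :=
    WellFounded.has_min (wellFounded_gt (α := Submodule (ZMod 2) (Multisign m))) 𝒲 hne
  have hrank : Module.finrank (ZMod 2) W ≤ m := by
    have := Submodule.finrank_le W
    simpa using this
  -- Otherwise appending the exchangeable pair `b`, `c` between `a` and `d` would enlarge `W`.
  have hstep : ∀ a b c d, a ∉ U ∪ S → b ∉ U ∪ S → c ∉ U ∪ S → d ∉ U ∪ S →
      [a, b, c, d].Nodup → triSum τ a b c + triSum τ d b c ∈ W := by
    intro a b c d ha hb hc hd hnd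
    by_contra hg
    simp only [Finset.mem_union, not_or] at ha hb hc hd
    have hlt : W < W ⊔ Submodule.span (ZMod 2) {triSum τ a b c + triSum τ d b c} := by
      refine lt_of_le_of_ne le_sup_left fun h => hg ?_
      rw [h]
      exact Submodule.mem_sup_right (Submodule.mem_span_singleton_self _)
    refine hmax _ ⟨u, d, _, hflex.append (flexible_four τ hnd) ?_, ?_, ?_⟩ hlt
    · rw [Finset.disjoint_right]
      intro x hx
      simp only [Finset.mem_insert, Finset.mem_singleton] at hx
      rcases hx with rfl | rfl | rfl | rfl <;> tauto
    · rw [Finset.disjoint_union_left]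
      refine ⟨hdisj, ?_⟩
      rw [Finset.disjoint_left]
      intro x hx
      simp only [Finset.mem_insert, Finset.mem_singleton] at hx
      rcases hx with rfl | rfl | rfl | rfl <;> tauto
    · have h1 := Submodule.finrank_lt_finrank_of_lt hlt
      have h2 := Finset.card_union_le S {a, b, c, d}
      have h3 : ({a, b, c, d} : Finset (Fin n)).card ≤ 4 := Finset.card_le_four
      omega
  have hBcard : (U ∪ S).card ≤ U.card + (4 * m + 1) := by
    have := Finset.card_union_le U S
    omega
  obtain ⟨x, y, z, hxy, hxz, hyz, hx, hy, hz, h0⟩ := exists_zero_triangle hη (U ∪ S)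
    (le_trans (Nat.mul_le_mul_left _ (by omega)) hn)
  refine ⟨u, v, S, W, hflex, hdisj, by omega, ?_⟩
  intro p q r hp hq hr hpq hpr hqr
  obtain ⟨a, b, c, ha, hb, hc, hab, hac, hbc⟩ :=
    exists_three_notMem (U ∪ S ∪ {p, q, r} ∪ {x, y, z}) (by
      have h1 := Finset.card_union_le (U ∪ S ∪ {p, q, r}) {x, y, z}
      have h2 := Finset.card_union_le (U ∪ S) {p, q, r}
      have h3 : ({x, y, z} : Finset (Fin n)).card ≤ 3 := Finset.card_le_three
      have h4 : ({p, q, r} : Finset (Fin n)).card ≤ 3 := Finset.card_le_three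
      have h5 : n ≥ U.card + (4 * m + 1) + 9 := by
        have : 48 * (U.card + 4 * m + 8) ≤ n :=
          le_trans (Nat.mul_le_mul_right _ (by omega)) hn
        omega
      omega)
  rw [Finset.mem_union, not_or, Finset.mem_union, not_or] at ha hb hc
  -- The triangles `pqr`, `qra`, `rab`, `abc` successively share an edge, so all agree modulo `W`.
  -- Comparing both `pqr` and the zero triangle with `abc` finishes the proof.
  have hmove : ∀ p q r, p ∉ U ∪ S → q ∉ U ∪ S → r ∉ U ∪ S → p ≠ q → p ≠ r → q ≠ r →
      a ∉ ({p, q, r} : Finset (Fin n)) → b ∉ ({p, q, r} : Finset (Fin n)) →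
      c ∉ ({p, q, r} : Finset (Fin n)) → triSum τ p q r + triSum τ c a b ∈ W := by
    intro p q r hp hq hr hpq hpr hqr ha' hb' hc'
    simp only [Finset.mem_insert, Finset.mem_singleton, not_or] at ha' hb' hc'
    have e1 := hstep p q r a hp hq hr ha.1.1
      (by simp [hpq, hpr, hqr, Ne.symm ha'.1, Ne.symm ha'.2.1, Ne.symm ha'.2.2])
    have e2 := hstep q r a b hq hr ha.1.1 hb.1.1
      (by simp [hqr, hab, Ne.symm ha'.2.1, Ne.symm ha'.2.2, Ne.symm hb'.2.1, Ne.symm hb'.2.2])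
    have e3 := hstep r a b c hr ha.1.1 hb.1.1 hc.1.1
      (by simp [hab, hac, hbc, Ne.symm ha'.2.2, Ne.symm hb'.2.2, Ne.symm hc'.2.2])
    rw [triSum_rotate τ a q r] at e1
    rw [triSum_rotate τ b r a] at e2
    have := W.add_mem (W.add_mem e1 e2) e3
    rwa [show triSum τ p q r + triSum τ q r a + (triSum τ q r a + triSum τ r a b) +
      (triSum τ r a b + triSum τ c a b) = triSum τ p q r + triSum τ c a b +
      ((triSum τ q r a + triSum τ q r a) + (triSum τ r a b + triSum τ r a b)) by abel,
      multisign_add_self, multisign_add_self, add_zero, add_zero] at this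
  have h1 := hmove p q r hp hq hr hpq hpr hqr ha.1.2 hb.1.2 hc.1.2
  have h2 := hmove x y z hx hy hz hxy hxz hyz ha.2 hb.2 hc.2
  rw [h0, zero_add] at h2
  have := W.add_mem h1 h2
  rwa [add_assoc, multisign_add_self, add_zero] at this

/-! ### Gadgets for almost-disjoint triangles -/

/-- A gadget for the triangle `abc` using two fresh vertices. -/
lemma exists_triangle_gadget {τ : Labelling (Fin n) m} {A : Finset (Fin n)}
    {W : Submodule (ZMod 2) (Multisign m)}
    (hY : ∀ p q r, p ∉ A → q ∉ A → r ∉ A → p ≠ q → p ≠ r → q ≠ r → triSum τ p q r ∈ W)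
    (hn : A.card + 2 ^ m + 2 ≤ n) {a b c : Fin n} (ha : a ∈ A) (hb : b ∈ A) (hc : c ∈ A)
    (hab : a ≠ b) (hac : a ≠ c) (hbc : b ≠ c) :
    ∃ p q g, p ∉ A ∧ q ∉ A ∧
      Flexible τ a q {a, b, p, c, q} (Submodule.span (ZMod 2) {g}) ∧
      triSum τ a b c + g ∈ W := by
  have hcompl : Aᶜ.card = n - A.card := by rw [Finset.card_compl, Fintype.card_fin]
  have hpos := Nat.one_le_two_pow (n := m)
  obtain ⟨y, hy⟩ : Aᶜ.Nonempty := by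
    rw [← Finset.card_pos]
    omega
  -- Pigeonhole on the `2 ^ m` multisigns makes `cpy` and `cqy` equal. By the tetrahedron relation
  -- `cpq` then has the multisign of `pqy`, which lies in `W`, although `c` belongs to `A`.
  obtain ⟨p, hp, q, hq, hpq, hf⟩ := Finset.exists_ne_map_eq_of_card_lt_of_maps_to
    (s := Aᶜ.erase y) (t := (Finset.univ : Finset (Multisign m)))
    (f := fun p => triSum τ c p y) (by
      have hM : (Finset.univ : Finset (Multisign m)).card = 2 ^ m := by simp [ZMod.card]
      rw [Finset.card_erase_of_mem hy, hcompl, hM]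
      omega) (fun _ _ => Finset.mem_coe.mpr (Finset.mem_univ _))
  simp only [Finset.mem_erase, Finset.mem_compl] at hp hq hy
  have hne : ∀ x ∈ A, x ≠ p ∧ x ≠ q := fun x hx =>
    ⟨fun h => hp.2 (h ▸ hx), fun h => hq.2 (h ▸ hx)⟩
  refine ⟨p, q, _, hp.2, hq.2, flexible_five τ ?_, ?_⟩
  · simp [hab, hac, hbc, hpq, hne a ha, hne b hb, hne c hc, (hne c hc).1.symm]
  · rw [← add_assoc, multisign_add_self, zero_add, triSum_tetrahedron τ c p q y]
    rw [hf, multisign_add_self, add_zero]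
    exact hY p q y hp.2 hq.2 hy hpq hp.1 hq.1

lemma exists_eq_insert_of_card_eq_three {V : Type} [DecidableEq V] {T : Finset V}
    (hT : T.card = 3) {w : V} (hw : w ∈ T) :
    ∃ a b, w ≠ a ∧ w ≠ b ∧ a ≠ b ∧ T = {w, a, b} := by
  have h2 : (T.erase w).card = 2 := by rw [Finset.card_erase_of_mem hw, hT]
  obtain ⟨a, b, hab, h⟩ := Finset.card_eq_two.mp h2
  have ha : a ∈ T.erase w := by simp [h]
  have hb : b ∈ T.erase w := by simp [h]
  refine ⟨a, b, (Finset.ne_of_mem_erase ha).symm, (Finset.ne_of_mem_erase hb).symm, hab, ?_⟩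
  rw [← h, Finset.insert_erase hw]

/-- Every family of almost-disjoint triangles can be made flexible. -/
lemma exists_flexible_of_almostDisjoint {τ : Labelling (Fin n) m} {U S₀ : Finset (Fin n)}
    {W : Submodule (ZMod 2) (Multisign m)} {u₀ v₀ : Fin n} (hflex : Flexible τ u₀ v₀ S₀ W)
    (hdisj : Disjoint S₀ U)
    (hY : ∀ p q r, p ∉ U ∪ S₀ → q ∉ U ∪ S₀ → r ∉ U ∪ S₀ → p ≠ q → p ≠ r → q ≠ r →
      triSum τ p q r ∈ W)
    {T : Fin m → Finset (Fin n)} (hT : ∀ i, (T i).card = 3) (hTU : ∀ i, T i ⊆ U)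
    (hAD : AlmostDisjoint T) (hn : U.card + S₀.card + 5 * m + 2 ^ m + 4 ≤ n)
    (I : Finset (Fin m)) :
    ∃ u v S G, Flexible τ u v S G ∧ S₀ ⊆ S ∧ W ≤ G ∧
      (∀ i ∈ I, triangleSign τ (T i) ∈ G) ∧ (∀ x ∈ S, x ∈ U → ∃ i ∈ I, x ∈ T i) ∧
      S.card ≤ S₀.card + 5 * I.card := by
  induction I using Finset.strongInduction with
  | H I ih =>
    rcases I.eq_empty_or_nonempty with rfl | ⟨i, hi⟩
    · exact ⟨u₀, v₀, S₀, W, hflex, subset_rfl, le_rfl, by simp,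
        fun x hx hxU => absurd hxU (Finset.disjoint_left.mp hdisj hx), by simp⟩
    have hIm : I.card ≤ m := by simpa using Finset.card_le_univ I
    -- Triangles are treated by components: an intersecting pair is removed together, since its
    -- gadgets must share a vertex.
    by_cases hex : ∃ j ∈ I, j ≠ i ∧ ¬ Disjoint (T i) (T j)
    · obtain ⟨j, hj, hji, hij⟩ := hex
      obtain ⟨w, hwi, hwj⟩ := Finset.not_disjoint_iff.mp hij
      have hj' : j ∈ I.erase i := Finset.mem_erase.mpr ⟨hji, hj⟩
      have hIcard : ((I.erase i).erase j).card + 2 = I.card := by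
        have h1 := Finset.card_erase_add_one hj'
        have h2 := Finset.card_erase_add_one hi
        omega
      obtain ⟨u, v, S, G, hS, hS₀, hWG, hG, hSU, hcard⟩ := ih ((I.erase i).erase j)
        ((Finset.erase_subset _ _).trans_ssubset (Finset.erase_ssubset hi))
      -- Since `T i` and `T j` meet, neither can be the one disjoint from the other two.
      have hfar : ∀ k ∈ (I.erase i).erase j, Disjoint (T k) (T i) ∧ Disjoint (T k) (T j) := by
        intro k hk
        simp only [Finset.mem_erase] at hk
        rcases hAD.2 i j k hji.symm hk.2.1.symm hk.1.symm with h | h | h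
        · exact absurd h.1 hij
        · exact absurd h.1.symm hij
        · exact h
      have hnot : ∀ x, x ∈ T i ∨ x ∈ T j → x ∉ S := by
        intro x hx hxS
        obtain ⟨k, hk, hxk⟩ := hSU x hxS (hx.elim (fun h => hTU i h) fun h => hTU j h)
        rcases hx with hx | hx
        · exact Finset.disjoint_left.mp (hfar k hk).1 hxk hx
        · exact Finset.disjoint_left.mp (hfar k hk).2 hxk hx
      obtain ⟨a, b, hwa, hwb, hab, hTi⟩ := exists_eq_insert_of_card_eq_three (hT i) hwi
      obtain ⟨c, d, hwc, hwd, hcd, hTj⟩ := exists_eq_insert_of_card_eq_three (hT j) hwj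
      have honly : ∀ x ∈ T i, x ∈ T j → x = w := by
        intro x hxi hxj
        exact Finset.card_le_one.mp (hAD.1 i j hji.symm) x (Finset.mem_inter.mpr ⟨hxi, hxj⟩) w
          (Finset.mem_inter.mpr ⟨hwi, hwj⟩)
      have hAcard := Finset.card_union_le U S
      have hiU : ∀ x ∈ T i, x ∈ U ∪ S := fun x hx => Finset.mem_union_left _ (hTU i hx)
      have hjU : ∀ x ∈ T j, x ∈ U ∪ S := fun x hx => Finset.mem_union_left _ (hTU j hx)
      have hY₁ : ∀ A : Finset (Fin n), U ∪ S ⊆ A → ∀ p q r, p ∉ A → q ∉ A → r ∉ A →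
          p ≠ q → p ≠ r → q ≠ r → triSum τ p q r ∈ W := fun A hA p q r hp hq hr =>
        hY p q r (fun h => hp (hA (Finset.union_subset_union_right hS₀ h)))
          (fun h => hq (hA (Finset.union_subset_union_right hS₀ h)))
          (fun h => hr (hA (Finset.union_subset_union_right hS₀ h)))
      obtain ⟨p, q, g, hp, hq, hf, hg⟩ := exists_triangle_gadget (hY₁ _ subset_rfl) (by omega)
        (hiU w hwi) (hiU a (by simp [hTi])) (hiU b (by simp [hTi])) hwa hwb hab
      have hAcard' := Finset.card_union_le (U ∪ S) {p, q}
      have hpq : ({p, q} : Finset (Fin n)).card ≤ 2 := Finset.card_le_two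
      -- The forbidden set now includes `p` and `q`, so the two gadgets meet only at `w`.
      obtain ⟨p', q', g', hp', hq', hf', hg'⟩ := exists_triangle_gadget
        (hY₁ (U ∪ S ∪ {p, q}) Finset.subset_union_left) (by omega)
        (Finset.mem_union_left _ (hjU w hwj)) (Finset.mem_union_left _ (hjU c (by simp [hTj])))
        (Finset.mem_union_left _ (hjU d (by simp [hTj]))) hwc hwd hcd
      simp only [Finset.mem_union, Finset.mem_insert, Finset.mem_singleton, not_or]
        at hp hq hp' hq'
      have hmi : ∀ x, x ∈ ({w, a, p, b, q} : Finset (Fin n)) → x ∈ T i ∨ x = p ∨ x = q := by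
        intro x hx
        rw [hTi]
        simp only [Finset.mem_insert, Finset.mem_singleton] at hx ⊢
        tauto
      have hmj : ∀ x, x ∈ ({w, c, p', d, q'} : Finset (Fin n)) →
          x ∈ T j ∨ x = p' ∨ x = q' := by
        intro x hx
        rw [hTj]
        simp only [Finset.mem_insert, Finset.mem_singleton] at hx ⊢
        tauto
      -- Both gadgets start at `w`; reversing the first makes `w` the inner vertex where they join.
      have hglue := hf.reverse.glue hf' (by
        intro x hx hx'
        rcases hmi x hx with h | rfl | rfl
        · rcases hmj x hx' with h' | rfl | rfl
          · exact honly x h h'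
          · exact absurd (hTU i h) hp'.1.1
          · exact absurd (hTU i h) hq'.1.1
        · rcases hmj x hx' with h' | rfl | rfl
          · exact absurd (hTU j h') hp.1
          · exact absurd rfl hp'.2.1
          · exact absurd rfl hq'.2.1
        · rcases hmj x hx' with h' | rfl | rfl
          · exact absurd (hTU j h') hq.1
          · exact absurd rfl hp'.2.2
          · exact absurd rfl hq'.2.2)
      have hall := hS.append hglue (by
        rw [Finset.disjoint_right]
        intro x hx
        rcases Finset.mem_union.mp hx with hx | hx
        · rcases hmi x hx with h | rfl | rfl
          · exact hnot x (Or.inl h)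
          · exact hp.2
          · exact hq.2
        · rcases hmj x hx with h | rfl | rfl
          · exact hnot x (Or.inr h)
          · exact hp'.1.2
          · exact hq'.1.2)
      refine ⟨_, _, _, _, hall, hS₀.trans Finset.subset_union_left, hWG.trans le_sup_left,
        ?_, ?_, ?_⟩
      · have hmem : ∀ t y : Multisign m, t + y ∈ W →
            y ∈ Submodule.span (ZMod 2) {g} ⊔ Submodule.span (ZMod 2) {g'} →
            t ∈ G ⊔ (Submodule.span (ZMod 2) {g} ⊔ Submodule.span (ZMod 2) {g'}) := by
          intro t y h1 h2
          exact (Submodule.add_mem_iff_left _ (Submodule.mem_sup_right h2)).mp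
            (Submodule.mem_sup_left (hWG h1))
        intro k hk
        by_cases hki : k = i
        · rw [hki, hTi, triangleSign_eq_triSum τ hwa hwb hab]
          exact hmem _ g hg (Submodule.mem_sup_left (Submodule.mem_span_singleton_self g))
        by_cases hkj : k = j
        · rw [hkj, hTj, triangleSign_eq_triSum τ hwc hwd hcd]
          exact hmem _ g' hg' (Submodule.mem_sup_right (Submodule.mem_span_singleton_self g'))
        · exact Submodule.mem_sup_left
            (hG k (Finset.mem_erase.mpr ⟨hkj, Finset.mem_erase.mpr ⟨hki, hk⟩⟩))
      · intro x hx hxU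
        rcases Finset.mem_union.mp hx with hx | hx
        · obtain ⟨k, hk, hxk⟩ := hSU x hx hxU
          exact ⟨k, Finset.mem_of_mem_erase (Finset.mem_of_mem_erase hk), hxk⟩
        rcases Finset.mem_union.mp hx with hx | hx
        · rcases hmi x hx with h | rfl | rfl
          · exact ⟨i, hi, h⟩
          · exact absurd hxU hp.1
          · exact absurd hxU hq.1
        · rcases hmj x hx with h | rfl | rfl
          · exact ⟨j, hj, h⟩
          · exact absurd hxU hp'.1.1
          · exact absurd hxU hq'.1.1
      · have h1 := Finset.card_union_le S ({w, a, p, b, q} ∪ {w, c, p', d, q'})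
        have h2 := Finset.card_union_le {w, a, p, b, q} ({w, c, p', d, q'} : Finset (Fin n))
        have h3 : ({w, a, p, b, q} : Finset (Fin n)).card ≤ 5 := Finset.card_le_five
        have h4 : ({w, c, p', d, q'} : Finset (Fin n)).card ≤ 5 := Finset.card_le_five
        omega
    · push Not at hex
      obtain ⟨u, v, S, G, hS, hS₀, hWG, hG, hSU, hcard⟩ := ih (I.erase i)
        (Finset.erase_ssubset hi)
      have hIcard := Finset.card_erase_add_one hi
      have hnot : ∀ x ∈ T i, x ∉ S := by
        intro x hx hxS
        obtain ⟨k, hk, hxk⟩ := hSU x hxS (hTU i hx)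
        rw [Finset.mem_erase] at hk
        exact Finset.disjoint_left.mp (hex k hk.2 hk.1) hx hxk
      obtain ⟨a, b, c, hab, hac, hbc, hTi⟩ := Finset.card_eq_three.mp (hT i)
      have hAcard := Finset.card_union_le U S
      have hiU : ∀ x ∈ T i, x ∈ U ∪ S := fun x hx => Finset.mem_union_left _ (hTU i hx)
      obtain ⟨p, q, g, hp, hq, hf, hg⟩ := exists_triangle_gadget (A := U ∪ S)
        (fun p q r hp hq hr =>
          hY p q r (fun h => hp (Finset.union_subset_union_right hS₀ h))
            (fun h => hq (Finset.union_subset_union_right hS₀ h))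
            (fun h => hr (Finset.union_subset_union_right hS₀ h))) (by omega)
        (hiU a (by simp [hTi])) (hiU b (by simp [hTi])) (hiU c (by simp [hTi])) hab hac hbc
      simp only [Finset.mem_union, not_or] at hp hq
      have hmi : ∀ x, x ∈ ({a, b, p, c, q} : Finset (Fin n)) → x ∈ T i ∨ x = p ∨ x = q := by
        intro x hx
        rw [hTi]
        simp only [Finset.mem_insert, Finset.mem_singleton] at hx ⊢
        tauto
      have hall := hS.append hf (by
        rw [Finset.disjoint_right]
        intro x hx
        rcases hmi x hx with h | rfl | rfl
        · exact hnot x h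
        · exact hp.2
        · exact hq.2)
      refine ⟨_, _, _, _, hall, hS₀.trans Finset.subset_union_left, hWG.trans le_sup_left,
        ?_, ?_, ?_⟩
      · intro k hk
        by_cases hki : k = i
        · rw [hki, hTi, triangleSign_eq_triSum τ hab hac hbc]
          exact (Submodule.add_mem_iff_left _
            (Submodule.mem_sup_right (Submodule.mem_span_singleton_self g))).mp
            (Submodule.mem_sup_left (hWG hg))
        · exact Submodule.mem_sup_left (hG k (Finset.mem_erase.mpr ⟨hki, hk⟩))
      · intro x hx hxU
        rcases Finset.mem_union.mp hx with hx | hx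
        · obtain ⟨k, hk, hxk⟩ := hSU x hx hxU
          exact ⟨k, Finset.mem_of_mem_erase hk, hxk⟩
        · rcases hmi x hx with h | rfl | rfl
          · exact ⟨i, hi, h⟩
          · exact absurd hxU hp.1
          · exact absurd hxU hq.1
      · have h1 := Finset.card_union_le S {a, b, p, c, q}
        have h3 : ({a, b, p, c, q} : Finset (Fin n)).card ≤ 5 := Finset.card_le_five
        omega

lemma HasAlmostDisjointIndependentTriangles.hamiltonianFull
    (hn : 48 * 2 ^ m * (7 * m + 8) ≤ n) {τ : Labelling (Fin n) m}
    (hη : ∀ t, eta τ t ≤ eta τ 0) (h : HasAlmostDisjointIndependentTriangles τ) :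
    HamiltonianFull τ := by
  obtain ⟨T, hT, hAD, hind⟩ := h
  have hpos : 1 ≤ 2 ^ m := Nat.one_le_two_pow
  set U := Finset.univ.biUnion T with hU
  have hUcard : U.card ≤ 3 * m := by
    refine Finset.card_biUnion_le.trans ?_
    simp [hT, mul_comm]
  have hTU : ∀ i, T i ⊆ U := fun i => Finset.subset_biUnion_of_mem T (Finset.mem_univ i)
  obtain ⟨u₀, v₀, S₀, W, hflex, hdisj, hcard, hY⟩ := exists_absorbing_flexible hη U
    (le_trans (Nat.mul_le_mul_left _ (by omega)) hn)
  obtain ⟨u, v, S, G, hS, -, -, hG, -⟩ := exists_flexible_of_almostDisjoint hflex hdisj hY hT hTU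
    hAD (by nlinarith) Finset.univ
  -- The `m` independent triangle multisigns in `G` already span the whole space.
  have hGtop : G = ⊤ := by
    rw [eq_top_iff, ← hind.span_eq_top_of_card_eq_finrank' (by simp), Submodule.span_le]
    rintro _ ⟨i, rfl⟩
    exact hG i (Finset.mem_univ i)
  exact (hGtop ▸ hS).hamiltonianFull

end

end Multisigned

theorem mainTheorem3 (m : ℕ) :
    ∃ N : ℕ, ∀ n : ℕ, N ≤ n →
      ∀ (σ : Multisigned.Labelling (Fin n) m) (x : Multisigned.Multisign m),
        x ≠ 0 →
        (∀ t : Multisigned.Multisign m, Multisigned.eta σ t ≤ Multisigned.eta σ x) →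
        Multisigned.HasIndependentTriangles σ →
        (∃ T : Finset (Fin n), T.card = 3 ∧ Multisigned.triangleSign σ T = 0) →
        ¬ Multisigned.IsSpecial (Multisigned.translate x σ) →
        Multisigned.hamiltonianSigns σ = Set.univ := by
  -- The triangles cover at most `3 * m` vertices, and absorption asks for `4 * m + 8` more; the
  -- path case needs only `2 * m + 2`.
  refine ⟨48 * 2 ^ m * (7 * m + 8), fun n hn σ x hx hη _ _ hspecial => ?_⟩
  have hpos : 1 ≤ 2 ^ m := Nat.one_le_two_pow
  have hm : 0 < m := by
    rcases Nat.eq_zero_or_pos m with rfl | h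
    · exact absurd (Subsingleton.elim x 0) hx
    · exact h
  have hη' : ∀ t, Multisigned.eta (Multisigned.translate x σ) t ≤
      Multisigned.eta (Multisigned.translate x σ) 0 := fun t => by
    rw [Multisigned.eta_translate, Multisigned.eta_translate, add_zero]
    exact hη _
  refine Multisigned.HamiltonianFull.hamiltonianSigns_eq (by nlinarith)
    (Multisigned.HamiltonianFull.of_translate (x := x) ?_)
  rw [Multisigned.IsSpecial, not_and_or, not_not, not_not] at hspecial
  rcases hspecial with h | h
  · exact h.hamiltonianFull hn hη'
  · exact h.hamiltonianFull hm (le_trans (Nat.mul_le_mul_left _ (by omega)) hn) hη'
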